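/- Let $X$ be a connected, locally path connected topological space and $x_0\in X$; write $[\alpha]$ for the homotopy class, relative to end points, of a path $\alpha$. For a subgroup $H\le\pi_1(X,x_0)$ let $\widetilde X_H$ be the set of classes $[\alpha]_H$ of paths $\alpha:[0,1]\to X$ with $\alpha(0)=x_0$, where $[\alpha]_H=[\beta]_H$ if and only if $\alpha(1)=\beta(1)$ and $[\alpha*\beta^{-1}]\in H$. Give $\widetilde X_H$ the (whisker) topology with basis the sets $N([\alpha]_H,U)=\{[\alpha*\delta]_H : \delta \text{ a path in } U,\ \delta(0)=\alpha(1)\}$, with $U$ an open neighbourhood of $\alpha(1)$ in $X$. Let $p_H:\widetilde X_H\to X$, $p_H([\alpha]_H)=\alpha(1)$, be the end point projection, and let $\tilde x_0\in\widetilde X_H$ be the class of the constant path at $x_0$. Let $\Sigma^{g}$ be the collection of all subgroups $H\le\pi_1(X,x_0)$ with $(p_H)_*\pi_1(\widetilde X_H,\tilde x_0)=H$. **Proposition.** The collection $\Sigma^{g}$ is a neighbourhood family, that is, it is non-empty and for all $H,K\in\Sigma^{g}$ there is $L\in\Sigma^{g}$ with $L\subseteq H\cap K$. The generalized covering topology on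 $\pi_1(X,x_0)$, that is, the topology whose basis consists of the left cosets $gH$ with $g\in\pi_1(X,x_0)$ and $H\in\Sigma^{g}$, is finer than (or equal to) the qtop-topology on $\pi_1(X,x_0)$, that is, the quotient topology induced by the map $\alpha\mapsto[\alpha]$ from the space of loops at $x_0$ with the compact-open topology. -/

import Mathlib

open scoped unitInterval Pointwise

noncomputable section

universe u

/-- The fundamental group with the concatenation product: `[α] * [β] = [α.trans β]`. Mathlib's
`FundamentalGroup` multiplies in the order of composition (`[α] * [β] = [β.trans α]`), so this is
its opposite group. -/
abbrev Pi1 (X : Type u) [TopologicalSpace X] (x : X) : Type u :=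
  (FundamentalGroup X x)ᵐᵒᵖ

namespace Pi1

/-- The homotopy class `[α]` of a loop `α`. -/
def ofLoop {X : Type u} [TopologicalSpace X] {x : X} (α : Path x x) : Pi1 X x :=
  MulOpposite.op (FundamentalGroup.fromPath (Path.Homotopic.Quotient.mk α))

theorem ofLoop_mul {X : Type u} [TopologicalSpace X] {x : X} (α β : Path x x) :
    ofLoop α * ofLoop β = ofLoop (α.trans β) := rfl

theorem ofLoop_one {X : Type u} [TopologicalSpace X] {x : X} :
    (1 : Pi1 X x) = ofLoop (Path.refl x) := rfl

theorem ofLoop_inv {X : Type u} [TopologicalSpace X] {x : X} (α : Path x x) :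
    (ofLoop α)⁻¹ = ofLoop α.symm := rfl

theorem ofLoop_eq_iff {X : Type u} [TopologicalSpace X] {x : X} {α β : Path x x} :
    ofLoop α = ofLoop β ↔ α.Homotopic β :=
  MulOpposite.op_injective.eq_iff.trans Path.Homotopic.Quotient.eq

/-- The homomorphism `f_* : π₁(X, x) → π₁(Y, y)` induced by a continuous map with `f x = y`. -/
def map {X Y : Type u} [TopologicalSpace X] [TopologicalSpace Y] (f : C(X, Y)) {x : X} {y : Y}
    (h : f x = y) : Pi1 X x →* Pi1 Y y :=
  (FundamentalGroup.mapOfEq f h).op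

theorem map_ofLoop {X Y : Type u} [TopologicalSpace X] [TopologicalSpace Y] (f : C(X, Y))
    {x : X} {y : Y} (h : f x = y) (α : Path x x) :
    map f h (ofLoop α) = ofLoop ((α.map f.continuous).cast h.symm h.symm) :=
  congrArg MulOpposite.op (FundamentalGroup.mapOfEq_apply f h _)

/-- The qtop-topology: the quotient topology along `Ω(X, x) → π₁(X, x)`, `α ↦ [α]`, where the loop
space carries the compact-open topology (Mathlib's topology on `Path x x`). -/
abbrev qtop (X : Type u) [TopologicalSpace X] (x : X) : TopologicalSpace (Pi1 X x) :=
  TopologicalSpace.coinduced ofLoop inferInstance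

end Pi1

/-! ### Subgroup topologies -/

/-- A non-empty family of subgroups, any two of which contain a common member of the family. -/
def IsNeighbourhoodFamily {G : Type u} [Group G] (S : Set (Subgroup G)) : Prop :=
  S.Nonempty ∧ ∀ H ∈ S, ∀ K ∈ S, ∃ L ∈ S, L ≤ H ⊓ K

/-- The topology on `G` generated by the left cosets `g • H`, `g ∈ G`, `H ∈ S`. -/
abbrev subgroupTopology {G : Type u} [Group G] (S : Set (Subgroup G)) : TopologicalSpace G :=
  TopologicalSpace.generateFrom {U | ∃ g : G, ∃ H ∈ S, U = g • (H : Set G)}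

/-- For a neighbourhood family, the left cosets are a basis of the subgroup topology. -/
theorem isTopologicalBasis_subgroupTopology {G : Type u} [Group G] {S : Set (Subgroup G)}
    (hS : IsNeighbourhoodFamily S) :
    @TopologicalSpace.IsTopologicalBasis G (subgroupTopology S)
      {U | ∃ g : G, ∃ H ∈ S, U = g • (H : Set G)} := by
  let _ := subgroupTopology S
  refine ⟨?_, ?_, rfl⟩
  · rintro _ ⟨g, H, hH, rfl⟩ _ ⟨k, K, hK, rfl⟩ x ⟨hx, hx'⟩
    obtain ⟨L, hL, hLHK⟩ := hS.2 H hH K hK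
    refine ⟨x • (L : Set G), ⟨x, L, hL, rfl⟩,
      Set.mem_smul_set_iff_inv_smul_mem.2 (by simp [L.one_mem]), ?_⟩
    rintro y hy
    rw [Set.mem_smul_set_iff_inv_smul_mem] at hx hx' hy
    have hy' := hLHK hy
    constructor <;> rw [Set.mem_smul_set_iff_inv_smul_mem]
    · simpa [mul_assoc] using H.mul_mem hx hy'.1
    · simpa [mul_assoc] using K.mul_mem hx' hy'.2
  · obtain ⟨H, hH⟩ := hS.1
    refine Set.eq_univ_of_forall fun x => ⟨x • (H : Set G), ⟨x, H, hH, rfl⟩, ?_⟩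
    exact Set.mem_smul_set_iff_inv_smul_mem.2 (by simp [H.one_mem])

/-! ### The path space relative to a subgroup -/

section RelPathSpace

variable {X : Type u} [TopologicalSpace X] {x₀ : X}

/-- `α ~ β` if `α` and `β` have the same end point and `[α * β⁻¹] ∈ H`. -/
def relPathRel (H : Subgroup (Pi1 X x₀)) (a b : Σ y : X, Path x₀ y) : Prop :=
  ∃ h : a.1 = b.1, Pi1.ofLoop (a.2.trans (b.2.cast rfl h).symm) ∈ H

theorem relPathRel_equivalence (H : Subgroup (Pi1 X x₀)) : Equivalence (relPathRel H) where
  refl := by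
    rintro ⟨y, α⟩
    refine ⟨rfl, ?_⟩
    have : Pi1.ofLoop (α.trans α.symm) = 1 :=
      Pi1.ofLoop_eq_iff.2 ⟨(Path.Homotopy.reflTransSymm α).symm⟩
    exact this ▸ H.one_mem
  symm := by
    rintro ⟨y, α⟩ ⟨z, β⟩ ⟨h, hm⟩
    obtain rfl : y = z := h
    refine ⟨rfl, ?_⟩
    have := H.inv_mem hm
    rw [Pi1.ofLoop_inv, Path.trans_symm, Path.symm_symm] at this
    exact this
  trans := by
    rintro ⟨y, α⟩ ⟨z, β⟩ ⟨w, γ⟩ ⟨h, hm⟩ ⟨h', hm'⟩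
    obtain rfl : y = z := h
    obtain rfl : y = w := h'
    refine ⟨rfl, ?_⟩
    have := H.mul_mem hm hm'
    rw [Pi1.ofLoop_mul] at this
    convert this using 1
    refine Pi1.ofLoop_eq_iff.2 (Path.Homotopic.Quotient.eq.1 ?_)
    change (Path.Homotopic.Quotient.mk α).trans (Path.Homotopic.Quotient.mk γ).symm =
      ((Path.Homotopic.Quotient.mk α).trans (Path.Homotopic.Quotient.mk β).symm).trans
        ((Path.Homotopic.Quotient.mk β).trans (Path.Homotopic.Quotient.mk γ).symm)
    rw [Path.Homotopic.Quotient.trans_assoc,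
      ← Path.Homotopic.Quotient.trans_assoc (Path.Homotopic.Quotient.mk β).symm,
      Path.Homotopic.Quotient.symm_trans, Path.Homotopic.Quotient.refl_trans]

/-- The set `X̃_H` of classes `[α]_H` of paths `α` in `X` that start at `x₀`. -/
def RelPathSpace (H : Subgroup (Pi1 X x₀)) : Type u :=
  Quotient (⟨relPathRel H, relPathRel_equivalence H⟩ : Setoid (Σ y : X, Path x₀ y))

namespace RelPathSpace

variable (H : Subgroup (Pi1 X x₀))

/-- The class `[α]_H`. -/
def mk {y : X} (α : Path x₀ y) : RelPathSpace H :=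
  Quotient.mk _ ⟨y, α⟩

theorem mk_eq_mk_iff {y : X} {α β : Path x₀ y} :
    mk H α = mk H β ↔ Pi1.ofLoop (α.trans β.symm) ∈ H :=
  Quotient.eq.trans ⟨fun ⟨_, h⟩ => h, fun h => ⟨rfl, h⟩⟩

/-- The class of the constant path. -/
def base : RelPathSpace H := mk H (Path.refl x₀)

/-- `N([α]_H, U)`: the classes `[α * δ]_H`, `δ` a path in `U` that starts at the end of `α`. -/
def nbhd {y : X} (α : Path x₀ y) (U : Set X) : Set (RelPathSpace H) :=
  {a | ∃ (z : X) (δ : Path y z), (∀ t, δ t ∈ U) ∧ a = mk H (α.trans δ)}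

/-- The (whisker) topology with the basis of all `N([α]_H, U)`, where `U` is an open neighbourhood
of the end point of `α`. -/
instance instTopologicalSpace : TopologicalSpace (RelPathSpace H) :=
  TopologicalSpace.generateFrom
    {V | ∃ (y : X) (α : Path x₀ y) (U : Set X), IsOpen U ∧ y ∈ U ∧ V = nbhd H α U}

theorem mem_nbhd_self {y : X} (α : Path x₀ y) {U : Set X} (hy : y ∈ U) :
    mk H α ∈ nbhd H α U := by
  refine ⟨y, Path.refl y, fun _ => hy, (mk_eq_mk_iff H).2 ?_⟩
  have : Pi1.ofLoop (α.trans (α.trans (Path.refl y)).symm) = 1 := by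
    refine Pi1.ofLoop_eq_iff.2 (Path.Homotopic.Quotient.eq.1 ?_)
    simp
  exact this ▸ H.one_mem

/-- The end point projection `p_H : X̃_H → X`, `[α]_H ↦ α(1)`. -/
def proj : C(RelPathSpace H, X) where
  toFun := Quotient.lift (fun a => a.1) fun _ _ h => h.1
  continuous_toFun := by
    refine continuous_def.2 fun U hU => ?_
    refine isOpen_iff_forall_mem_open.2 fun a => ?_
    refine Quotient.inductionOn a ?_
    rintro ⟨y, α⟩ (hy : y ∈ U)
    refine ⟨nbhd H α U, ?_, TopologicalSpace.isOpen_generateFrom_of_mem ⟨y, α, U, hU, hy, rfl⟩,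
      mem_nbhd_self H α hy⟩
    rintro _ ⟨z, δ, hδ, rfl⟩
    change z ∈ U
    simpa using hδ 1

theorem proj_mk {y : X} (α : Path x₀ y) : proj H (mk H α) = y := rfl

theorem proj_base : proj H (base H) = x₀ := rfl

end RelPathSpace

end RelPathSpace

/-- The subgroups `H` of `π₁(X, x₀)` with `(p_H)_* π₁(X̃_H, x̃_0) = H`. -/
def gcovFamily (X : Type u) [TopologicalSpace X] (x₀ : X) : Set (Subgroup (Pi1 X x₀)) :=
  {H | (Pi1.map (RelPathSpace.proj H) (RelPathSpace.proj_base H)).range = H}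

/-- The generalized covering topology on `π₁(X, x₀)`. -/
abbrev gcovTopology (X : Type u) [TopologicalSpace X] (x₀ : X) : TopologicalSpace (Pi1 X x₀) :=
  subgroupTopology (gcovFamily X x₀)

end

universe u

open Set Filter Topology

/-! ### Separate continuity in the qtop-topology -/

namespace Pi1

variable {X : Type u} [TopologicalSpace X] {x : X}

/-! In qtop, translations and inversion are continuous. Hence the intersection `C` of all open
neighbourhoods of `1` is a closed subgroup, and every open set is a union of left cosets of `C`. It
therefore suffices that `C` lies in the family, and in fact every closed subgroup `H` does
(`mem_gcovFamily_of_isOpen_compl`): a loop in `X̃_H` with projection `α` can be approximated by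
loops `γ` in the compact-open topology, arbitrarily close to `α`, with `[γ] ∈ H`
(`exists_path_graph_subset`), so `[α] ∈ H`. The family is closed under intersection: `H` always lies
in the image of `(p_H)_*` by lifting loops, and that image is monotone in `H`. -/

theorem ofLoop_surjective : Function.Surjective (ofLoop : Path x x → Pi1 X x) := by
  intro g
  obtain ⟨α, hα⟩ := Path.Homotopic.Quotient.mk_surjective (FundamentalGroup.toPath g.unop)
  exact ⟨α, congrArg (fun a => MulOpposite.op (FundamentalGroup.fromPath a)) hα⟩

/-- Concatenation with a fixed loop is continuous on the loop space and descends to the quotient.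
Joint continuity of the product is not needed. -/
theorem isOpen_preimage_mul_left {U : Set (Pi1 X x)} (hU : IsOpen[qtop X x] U) (g : Pi1 X x) :
    IsOpen[qtop X x] {a | g * a ∈ U} := by
  obtain ⟨α, rfl⟩ := ofLoop_surjective g
  exact IsOpen.preimage (f := fun β : Path x x => α.trans β)
    (continuous_const.path_trans continuous_id) (isOpen_coinduced.1 hU)

theorem isOpen_preimage_mul_right {U : Set (Pi1 X x)} (hU : IsOpen[qtop X x] U) (g : Pi1 X x) :
    IsOpen[qtop X x] {a | a * g ∈ U} := by
  obtain ⟨α, rfl⟩ := ofLoop_surjective g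
  exact IsOpen.preimage (f := fun β : Path x x => β.trans α)
    (continuous_id.path_trans continuous_const) (isOpen_coinduced.1 hU)

theorem isOpen_preimage_inv {U : Set (Pi1 X x)} (hU : IsOpen[qtop X x] U) :
    IsOpen[qtop X x] {a | a⁻¹ ∈ U} :=
  IsOpen.preimage (f := fun β : Path x x => β.symm) Path.continuous_symm (isOpen_coinduced.1 hU)

/-- The intersection of all neighbourhoods of `1` in the qtop-topology. -/
def qtopKernel (X : Type u) [TopologicalSpace X] (x : X) : Subgroup (Pi1 X x) where
  carrier := {c | ∀ U, IsOpen[qtop X x] U → 1 ∈ U → c ∈ U}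
  one_mem' := fun _ _ h => h
  mul_mem' := fun {a b} ha hb U hU h1 =>
    ha {c | c * b ∈ U} (isOpen_preimage_mul_right hU b) (by simpa using hb U hU h1)
  inv_mem' := fun {a} ha U hU h1 =>
    ha {c | c⁻¹ ∈ U} (isOpen_preimage_inv hU) (by simpa using h1)

/-- Open sets are unions of left cosets of the kernel. -/
theorem mul_mem_of_mem_qtopKernel {U : Set (Pi1 X x)} (hU : IsOpen[qtop X x] U) {g c : Pi1 X x}
    (hg : g ∈ U) (hc : c ∈ qtopKernel X x) : g * c ∈ U :=
  hc {a | g * a ∈ U} (isOpen_preimage_mul_left hU g) (by simpa using hg)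

theorem isOpen_compl_qtopKernel :
    IsOpen[qtop X x] ((qtopKernel X x : Set (Pi1 X x))ᶜ) := by
  let _ := qtop X x
  refine isOpen_iff_forall_mem_open.2 fun c hc => ?_
  obtain ⟨U, hU, h1, hcU⟩ : ∃ U, IsOpen[qtop X x] U ∧ 1 ∈ U ∧ c ∉ U := by
    by_contra! h
    exact hc h
  -- If some `a` in the kernel had `a⁻¹ * c ∈ U`, then `{b | b * (a⁻¹ * c) ∈ U}` would be an open
  -- neighbourhood of `1`, hence contain `a`, which gives `c ∈ U`.
  refine ⟨{a | a⁻¹ * c ∈ U}, fun a ha haC => hcU ?_,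
    isOpen_preimage_inv (isOpen_preimage_mul_right hU c), by simpa using h1⟩
  have := haC {b | b * (a⁻¹ * c) ∈ U} (isOpen_preimage_mul_right hU _) (by simpa using ha)
  simpa using this

end Pi1

/-! ### Lifting loops to `X̃_H` and monotonicity in `H` -/

namespace RelPathSpace

variable {X : Type u} [TopologicalSpace X] {x₀ : X} (H : Subgroup (Pi1 X x₀))

theorem mk_eq_of_homotopic {y : X} {α β : Path x₀ y} (h : α.Homotopic β) : mk H α = mk H β := by
  refine (mk_eq_mk_iff H).2 ?_
  have : Pi1.ofLoop (α.trans β.symm) = 1 := by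
    refine Pi1.ofLoop_eq_iff.2 (Path.Homotopic.Quotient.eq.1 ?_)
    simp [Path.Homotopic.Quotient.eq.2 h]
  exact this ▸ H.one_mem

theorem exists_eq_mk (a : RelPathSpace H) : ∃ (y : X) (α : Path x₀ y), a = mk H α := by
  induction a using Quotient.inductionOn with
  | _ a => exact ⟨a.1, a.2, rfl⟩

theorem mk_trans_congr {y z : X} {α β : Path x₀ y} (h : mk H α = mk H β) (δ : Path y z) :
    mk H (α.trans δ) = mk H (β.trans δ) := by
  rw [mk_eq_mk_iff] at h ⊢
  convert h using 1
  refine Pi1.ofLoop_eq_iff.2 (Path.Homotopic.Quotient.eq.1 ?_)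
  change ((Path.Homotopic.Quotient.mk α).trans (Path.Homotopic.Quotient.mk δ)).trans
      ((Path.Homotopic.Quotient.mk β).trans (Path.Homotopic.Quotient.mk δ)).symm =
    (Path.Homotopic.Quotient.mk α).trans (Path.Homotopic.Quotient.mk β).symm
  rw [← Path.Homotopic.Quotient.mk_trans β δ, ← Path.Homotopic.Quotient.mk_symm, Path.trans_symm,
    Path.Homotopic.Quotient.mk_trans, Path.Homotopic.Quotient.trans_assoc,
    ← Path.Homotopic.Quotient.trans_assoc (Path.Homotopic.Quotient.mk δ)]
  simp

theorem mk_trans_assoc {y z w : X} (α : Path x₀ y) (β : Path y z) (γ : Path z w) :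
    mk H ((α.trans β).trans γ) = mk H (α.trans (β.trans γ)) :=
  mk_eq_of_homotopic H ⟨Path.Homotopy.transAssoc α β γ⟩

theorem eq_of_mk_eq_mk {y z : X} {α : Path x₀ y} {β : Path x₀ z} (h : mk H α = mk H β) : y = z :=
  congrArg (proj H) h

theorem isOpen_nbhd {y : X} (α : Path x₀ y) {U : Set X} (hU : IsOpen U) (hy : y ∈ U) :
    IsOpen (nbhd H α U) :=
  TopologicalSpace.isOpen_generateFrom_of_mem ⟨y, α, U, hU, hy, rfl⟩

/-- The class of the initial segment `α|_[0, t]`. -/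
def initialSegment {y : X} (α : Path x₀ y) (t : I) : RelPathSpace H :=
  mk H ((α.subpath 0 t).cast α.source.symm rfl)

theorem initialSegment_trans_subpath {y : X} (α : Path x₀ y) (s t : I) :
    mk H (((α.subpath 0 s).cast α.source.symm rfl).trans (α.subpath s t)) =
      initialSegment H α t :=
  mk_eq_of_homotopic H (Path.Homotopic.pathCast
    (⟨Path.Homotopy.subpathTransSubpath α 0 s t⟩ :
      ((α.subpath 0 s).trans (α.subpath s t)).Homotopic (α.subpath 0 t)) α.source.symm rfl)

theorem continuous_initialSegment {y : X} (α : Path x₀ y) :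
    Continuous (initialSegment H α) := by
  refine continuous_generateFrom_iff.2 ?_
  rintro _ ⟨z, β, U, hU, -, rfl⟩
  refine isOpen_iff_mem_nhds.2 fun t ⟨w, δ, hδ, ht⟩ => ?_
  obtain rfl : α t = w := eq_of_mk_eq_mk H ht
  have hαt : α ⁻¹' U ∈ 𝓝 t := α.continuous.continuousAt (hU.mem_nhds (by simpa using hδ 1))
  -- For `s` near `t`, on either side, `α` maps the interval between them into `U`, so appending
  -- `α.subpath t s` to `δ` stays in `U`.
  have hev : ∀ᶠ s in 𝓝 t, uIcc t s ⊆ α ⁻¹' U :=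
    (tendsto_const_nhds.uIcc tendsto_id).eventually (eventually_smallSets_subset.2 hαt)
  filter_upwards [hev] with s hs
  refine ⟨α s, δ.trans (α.subpath t s), fun r => ?_, ?_⟩
  · have hr : (δ.trans (α.subpath t s)) r ∈ range (δ.trans (α.subpath t s)) := ⟨r, rfl⟩
    rw [Path.trans_range, Path.range_subpath] at hr
    rcases hr with ⟨q, hq⟩ | ⟨q, hq, hq'⟩
    · exact hq ▸ hδ q
    · exact hq' ▸ hs hq
  · rw [← initialSegment_trans_subpath H α t s, ← mk_trans_assoc]
    exact mk_trans_congr H ht _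

theorem initialSegment_zero {y : X} (α : Path x₀ y) : initialSegment H α 0 = base H := by
  unfold initialSegment base
  rw [Path.subpath_self]
  have (z : X) (h : x₀ = z) : mk H ((Path.refl z).cast h rfl) = mk H (Path.refl x₀) := by
    subst h
    rfl
  exact this _ α.source.symm

theorem initialSegment_one {y : X} (α : Path x₀ y) : initialSegment H α 1 = mk H α := by
  unfold initialSegment
  rw [Path.subpath_zero_one]
  have (z : X) (h : z = y) : mk H (α.cast rfl h) = mk H α := by
    subst h
    rfl
  exact this _ α.target

theorem mk_eq_base_iff (α : Path x₀ x₀) : mk H α = base H ↔ Pi1.ofLoop α ∈ H := by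
  rw [base, mk_eq_mk_iff]
  have : Pi1.ofLoop (α.trans (Path.refl x₀).symm) = Pi1.ofLoop α := mul_one (Pi1.ofLoop α)
  rw [this]

/-- The initial segments of `α` form a lift of `α` that starts at the base point; it closes up
exactly when `[α] ∈ H`. -/
theorem le_range_map_proj : H ≤ (Pi1.map (proj H) (proj_base H)).range := by
  intro g hg
  obtain ⟨α, rfl⟩ := Pi1.ofLoop_surjective g
  let L : Path (base H) (base H) :=
    { toFun := initialSegment H α
      continuous_toFun := continuous_initialSegment H α
      source' := initialSegment_zero H α
      target' := (initialSegment_one H α).trans ((mk_eq_base_iff H α).2 hg) }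
  exact ⟨Pi1.ofLoop L, (Pi1.map_ofLoop _ _ L).trans (congrArg Pi1.ofLoop (Path.ext rfl))⟩

/-- The projection `X̃_H → X̃_K` for `H ≤ K`. -/
def ofLE {H K : Subgroup (Pi1 X x₀)} (h : H ≤ K) : C(RelPathSpace H, RelPathSpace K) where
  toFun := Quotient.map id fun _ _ ⟨he, hm⟩ => ⟨he, h hm⟩
  continuous_toFun := by
    refine continuous_generateFrom_iff.2 ?_
    rintro _ ⟨z, β, U, hU, -, rfl⟩
    refine isOpen_iff_forall_mem_open.2 fun a ha => ?_
    obtain ⟨y, α, rfl⟩ := exists_eq_mk H a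
    obtain ⟨w, δ, hδ, ht⟩ := ha
    obtain rfl : y = w := eq_of_mk_eq_mk K ht
    have hy : y ∈ U := by simpa using hδ 1
    refine ⟨nbhd H α U, ?_, isOpen_nbhd H α hU hy, mem_nbhd_self H α hy⟩
    rintro _ ⟨v, ε, hε, rfl⟩
    refine ⟨v, δ.trans ε, fun r => ?_, (mk_trans_congr K ht ε).trans (mk_trans_assoc K β δ ε)⟩
    have hr : δ.trans ε r ∈ range (δ.trans ε) := ⟨r, rfl⟩
    rw [Path.trans_range] at hr
    rcases hr with ⟨q, hq⟩ | ⟨q, hq⟩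
    · exact hq ▸ hδ q
    · exact hq ▸ hε q

theorem proj_ofLE {H K : Subgroup (Pi1 X x₀)} (h : H ≤ K) (a : RelPathSpace H) :
    proj K (ofLE h a) = proj H a := by
  obtain ⟨y, α, rfl⟩ := exists_eq_mk H a
  rfl

theorem ofLE_base {H K : Subgroup (Pi1 X x₀)} (h : H ≤ K) : ofLE h (base H) = base K := rfl

theorem range_map_proj_mono {H K : Subgroup (Pi1 X x₀)} (h : H ≤ K) :
    (Pi1.map (proj H) (proj_base H)).range ≤ (Pi1.map (proj K) (proj_base K)).range := by
  rintro _ ⟨g, rfl⟩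
  obtain ⟨L, rfl⟩ := Pi1.ofLoop_surjective g
  refine ⟨Pi1.ofLoop ((L.map (ofLE h).continuous).cast (ofLE_base h).symm (ofLE_base h).symm), ?_⟩
  rw [Pi1.map_ofLoop, Pi1.map_ofLoop]
  exact congrArg Pi1.ofLoop (Path.ext (funext fun t => proj_ofLE h (L t)))

end RelPathSpace

theorem inf_mem_gcovFamily {X : Type u} [TopologicalSpace X] {x₀ : X} {H K : Subgroup (Pi1 X x₀)}
    (hH : H ∈ gcovFamily X x₀) (hK : K ∈ gcovFamily X x₀) : H ⊓ K ∈ gcovFamily X x₀ :=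
  le_antisymm
    (le_inf ((RelPathSpace.range_map_proj_mono inf_le_left).trans_eq hH)
      ((RelPathSpace.range_map_proj_mono inf_le_right).trans_eq hK))
    (RelPathSpace.le_range_map_proj _)

/-! ### Graph neighbourhoods and strictly increasing time changes -/

/-- The compact-open topology is coarser than the graph topology. -/
theorem ContinuousMap.exists_isOpen_graph_of_mem_nhds {A B : Type*} [TopologicalSpace A] [T2Space A]
    [TopologicalSpace B] {f : C(A, B)} {V : Set C(A, B)} (hV : V ∈ 𝓝 f) :
    ∃ G : Set (A × B), IsOpen G ∧ (∀ a, (a, f a) ∈ G) ∧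
      ∀ g : C(A, B), (∀ a, (a, g a) ∈ G) → g ∈ V := by
  let graph (g : C(A, B)) : Set (A × B) := range fun a => (a, g a)
  -- The filter on the left consists of the graph neighbourhoods of `f`.
  have key : Tendsto id (comap graph (𝓝ˢ (graph f)).smallSets) (𝓝 f) := by
    refine ContinuousMap.tendsto_nhds_compactOpen.2 fun K hK U hU hf => ?_
    -- A graph inside this set belongs to a map that sends `K` into `U`; the set is open because
    -- compact sets are closed in a Hausdorff space.
    have hG : (Kᶜ ×ˢ univ ∪ univ ×ˢ U : Set (A × B)) ∈ 𝓝ˢ (graph f) := by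
      refine ((hK.isClosed.isOpen_compl.prod isOpen_univ).union
        (isOpen_univ.prod hU)).mem_nhdsSet.2 ?_
      rintro _ ⟨a, rfl⟩
      by_cases ha : a ∈ K
      · exact Or.inr ⟨trivial, hf ha⟩
      · exact Or.inl ⟨ha, trivial⟩
    filter_upwards [preimage_mem_comap (eventually_smallSets_subset.2 hG)] with g hg a ha
    rcases hg ⟨a, rfl⟩ with h | h
    · exact absurd ha h.1
    · exact h.2
  obtain ⟨S, hS, hSV⟩ := mem_comap.1 (key hV)
  obtain ⟨T, hT, hTS⟩ := (basis_sets _).smallSets.mem_iff.1 hS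
  obtain ⟨G, hG, hfG, hGT⟩ := mem_nhdsSet_iff_exists.1 hT
  refine ⟨G, hG, fun a => hfG ⟨a, rfl⟩, fun g hg => hSV (hTS ?_)⟩
  refine Subset.trans ?_ hGT
  rintro _ ⟨a, rfl⟩
  exact hg a

theorem Path.strictMono_trans {a b c : I} {φ : Path a b} {ψ : Path b c} (hφ : StrictMono φ)
    (hψ : StrictMono ψ) : StrictMono (φ.trans ψ) := by
  refine StrictMonoOn.Iic_union_Ici (a := ⟨1 / 2, by norm_num, by norm_num⟩) ?_ ?_
  · intro s hs t ht hst
    have hs' : (s : ℝ) ≤ 1 / 2 := hs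
    have ht' : (t : ℝ) ≤ 1 / 2 := ht
    have hst' : (s : ℝ) < t := hst
    rw [Path.trans_apply, Path.trans_apply, dif_pos hs', dif_pos ht']
    exact hφ (Subtype.coe_lt_coe.1 (by simpa using hst'))
  -- At `t = 1/2` the definition takes the first branch, where both formulas give `b`.
  · have key (t : I) (ht : 1 / 2 ≤ (t : ℝ)) : (φ.trans ψ) t =
        ψ ⟨2 * t - 1, unitInterval.two_mul_sub_one_mem_iff.2 ⟨ht, t.2.2⟩⟩ := by
      rw [Path.trans_apply]
      split_ifs with h
      · have ht' : (t : ℝ) = 1 / 2 := le_antisymm h ht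
        simp [ht']
      · rfl
    intro s hs t ht hst
    have hst' : (s : ℝ) < t := hst
    rw [key s hs, key t ht]
    exact hψ (Subtype.coe_lt_coe.1 (by simpa using hst'))

theorem unitInterval.exists_strictMono_path {a b : I} (h : a < b) :
    ∃ φ : Path a b, StrictMono φ ∧ ∀ t, φ t ∈ Icc a b := by
  refine ⟨⟨⟨Icc.convexComb a b, Icc.continuous_convexComb a b⟩, by simp, by simp⟩, ?_,
    fun t => ⟨Icc.le_convexComb h.le t, Icc.convexComb_le h.le t⟩⟩
  intro s t hst
  have h' : (a : ℝ) < b := h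
  have hst' : (s : ℝ) < t := hst
  refine Subtype.coe_lt_coe.1 ?_
  change (1 - s : ℝ) * a + s * b < (1 - t) * a + t * b
  nlinarith

theorem Path.forall_trans {X : Type*} [TopologicalSpace X] {x y z : X} {γ : Path x y}
    {δ : Path y z} {a b c : I} {φ : Path a b} {ψ : Path b c} {G : Set (I × X)}
    (hγ : ∀ t, (φ t, γ t) ∈ G) (hδ : ∀ t, (ψ t, δ t) ∈ G) (t : I) :
    (φ.trans ψ t, γ.trans δ t) ∈ G := by
  rw [Path.trans_apply, Path.trans_apply]
  split_ifs
  · exact hγ _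
  · exact hδ _

/-! ### Approximating projections of paths in `X̃_H` -/

namespace RelPathSpace

variable {X : Type u} [TopologicalSpace X] {x₀ : X} (H : Subgroup (Pi1 X x₀))

/-- Two points of `N([β]_H, U)` are joined through the end of `β`: run back along the first tail,
then out along the second. -/
theorem exists_trans_of_mem_nbhd {y : X} {β : Path x₀ y} {U : Set X} {a b : RelPathSpace H}
    (ha : a ∈ nbhd H β U) (hb : b ∈ nbhd H β U) {z : X} {γ : Path x₀ z} (hγ : mk H γ = a) :
    ∃ (w : X) (δ : Path z w), (∀ t, δ t ∈ U) ∧ mk H (γ.trans δ) = b := by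
  obtain ⟨z', ε, hε, rfl⟩ := ha
  obtain ⟨w, ε', hε', rfl⟩ := hb
  obtain rfl : z = z' := eq_of_mk_eq_mk H hγ
  refine ⟨w, ε.symm.trans ε', fun t => ?_, ?_⟩
  · rw [Path.trans_apply]
    split_ifs
    · exact hε _
    · exact hε' _
  · rw [mk_trans_congr H hγ, mk_trans_assoc]
    refine mk_eq_of_homotopic H (Path.Homotopic.Quotient.eq.1 ?_)
    simp only [Path.Homotopic.Quotient.mk_trans, Path.Homotopic.Quotient.mk_symm]
    rw [← Path.Homotopic.Quotient.trans_assoc (Path.Homotopic.Quotient.mk ε)]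
    simp

/-- A path in `X̃_H` from the base point is, at its end, represented by paths whose graphs are
arbitrarily close to the graph of its projection. -/
theorem exists_path_graph_subset {a : RelPathSpace H} (L : Path (base H) a) {G : Set (I × X)}
    (hG : IsOpen G) (hL : ∀ t, (t, proj H (L t)) ∈ G) :
    ∃ (z : X) (γ : Path x₀ z), mk H γ = a ∧ ∀ t, (t, γ t) ∈ G := by
  -- Boxes `W ×ˢ U` inside `G` with `L` mapping `W` into one basic set: over `W`, any path in `U`
  -- has its graph in `G`, whatever its parametrization.
  have hloc (t : I) : ∃ W : Set I, IsOpen W ∧ t ∈ W ∧ ∃ (U : Set X) (y : X) (β : Path x₀ y),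
      W ×ˢ U ⊆ G ∧ ∀ s ∈ W, L s ∈ nbhd H β U := by
    obtain ⟨y, β, hβ⟩ := exists_eq_mk H (L t)
    obtain ⟨W, U, hW, hU, ht, hy, hWU⟩ := isOpen_prod_iff.1 hG t y
      (by simpa [hβ, proj_mk] using hL t)
    refine ⟨W ∩ L ⁻¹' nbhd H β U, hW.inter ((isOpen_nbhd H β hU hy).preimage L.continuous),
      ⟨ht, ?_⟩, U, y, β, fun p hp => hWU ⟨hp.1.1, hp.2⟩, fun s hs => hs.2⟩
    rw [mem_preimage, hβ]
    exact mem_nbhd_self H β hy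
  choose W hW htW U y β hWU hβ using hloc
  obtain ⟨t, ht0, htm, ⟨N, hN⟩, ht⟩ :=
    exists_monotone_Icc_subset_open_cover_unitInterval hW fun s _ => mem_iUnion.2 ⟨s, htW s⟩
  have step (n : ℕ) (hn : t n < t (n + 1)) {z : X} {γ : Path x₀ z} (hγ : mk H γ = L (t n)) :
      ∃ (w : X) (δ : Path z w) (φ : Path (t n) (t (n + 1))), StrictMono φ ∧
        mk H (γ.trans δ) = L (t (n + 1)) ∧ ∀ s, (φ s, δ s) ∈ G := by
    obtain ⟨i, hi⟩ := ht n
    obtain ⟨w, δ, hδ, hw⟩ := exists_trans_of_mem_nbhd H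
      (hβ i _ (hi (left_mem_Icc.2 hn.le))) (hβ i _ (hi (right_mem_Icc.2 hn.le))) hγ
    obtain ⟨φ, hφ, hφ'⟩ := unitInterval.exists_strictMono_path hn
    exact ⟨w, δ, φ, hφ, hw, fun s => hWU i ⟨hi (hφ' s), hδ s⟩⟩
  -- `φ` records the time at which each point of `γ` is to be visited. The case `t n = 0` is
  -- separate because no strictly increasing path runs from `0` to `0`.
  have main (n : ℕ) : t n = 0 ∨ ∃ (z : X) (γ : Path x₀ z) (φ : Path 0 (t n)), StrictMono φ ∧
      mk H γ = L (t n) ∧ ∀ s, (φ s, γ s) ∈ G := by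
    induction n with
    | zero => exact Or.inl ht0
    | succ n ih =>
      rcases (htm n.le_succ).eq_or_lt with hn | hn
      · rwa [← hn]
      right
      rcases ih with h0 | ⟨z, γ, φ, hφ, hγ, hφγ⟩
      · obtain ⟨w, δ, φ, hφ, hw, hδ⟩ := step n hn (γ := Path.refl x₀) (by rw [h0, L.source]; rfl)
        refine ⟨w, δ, φ.cast h0.symm rfl, hφ, hw ▸ mk_eq_of_homotopic H ?_, hδ⟩
        exact ⟨(Path.Homotopy.reflTrans δ).symm⟩
      · obtain ⟨w, δ, ψ, hψ, hw, hδ⟩ := step n hn hγ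
        exact ⟨w, γ.trans δ, φ.trans ψ, Path.strictMono_trans hφ hψ, hw,
          Path.forall_trans hφγ hδ⟩
  have hN1 : t N = 1 := hN N le_rfl
  rcases main N with h0 | ⟨z, γ, φ, hφ, hγ, hφγ⟩
  · exact absurd (hN1.symm.trans h0) one_ne_zero
  have hsurj : Function.Surjective φ := by
    intro s
    obtain ⟨r, -, hr⟩ := intermediate_value_Icc (zero_le_one' I) φ.continuous.continuousOn
      (show s ∈ Icc (φ 0) (φ 1) by
        rw [φ.source, φ.target, hN1]
        exact ⟨s.2.1, s.2.2⟩)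
    exact ⟨r, hr⟩
  -- Reparametrizing `γ` by the inverse of `φ` turns the pairs `(φ s, γ s)` into a graph over `I`
  -- without changing the homotopy class.
  let e : I ≃o I := hφ.orderIsoOfSurjective φ hsurj
  have he (s : I) : φ (e.symm s) = s := e.apply_symm_apply s
  refine ⟨z, γ.reparam e.symm e.symm.continuous e.symm.map_bot e.symm.map_top, ?_, fun s => ?_⟩
  · rw [← mk_eq_of_homotopic H ⟨Path.Homotopy.reparam γ _ _ _ _⟩, hγ, hN1, L.target]
  · simpa [he] using hφγ (e.symm s)

end RelPathSpace

/-- If `[α] ∉ H` for the projection `α` of a loop at the base point of `X̃_H`, then all loops near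
`α` have classes outside `H`. But some `γ` near `α` represents the end of the loop, which is the
base point, so `[γ] ∈ H`. -/
theorem mem_gcovFamily_of_isOpen_compl {X : Type u} [TopologicalSpace X] {x₀ : X}
    {H : Subgroup (Pi1 X x₀)} (hH : IsOpen[Pi1.qtop X x₀] (H : Set (Pi1 X x₀))ᶜ) :
    H ∈ gcovFamily X x₀ := by
  refine le_antisymm ?_ (RelPathSpace.le_range_map_proj H)
  rintro _ ⟨g, rfl⟩
  obtain ⟨L, rfl⟩ := Pi1.ofLoop_surjective g
  rw [Pi1.map_ofLoop]
  set α : Path x₀ x₀ := (L.map (RelPathSpace.proj H).continuous).cast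
    (RelPathSpace.proj_base H).symm (RelPathSpace.proj_base H).symm
  by_contra hα
  obtain ⟨V, hV, hVH⟩ := isOpen_induced_iff.1 (isOpen_coinduced.1 hH)
  have hαV : (α : C(I, X)) ∈ V := by
    change α ∈ (fun γ : Path x₀ x₀ => (γ : C(I, X))) ⁻¹' V
    rw [hVH]
    exact hα
  obtain ⟨G, hG, hαG, hGV⟩ :=
    ContinuousMap.exists_isOpen_graph_of_mem_nhds (hV.mem_nhds hαV)
  obtain ⟨z, γ, hγ, hγG⟩ := RelPathSpace.exists_path_graph_subset H L hG hαG
  obtain rfl : z = x₀ := RelPathSpace.eq_of_mk_eq_mk H hγ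
  have hγV : γ ∈ (fun γ : Path z z => (γ : C(I, X))) ⁻¹' V := hGV γ hγG
  rw [hVH] at hγV
  exact hγV ((RelPathSpace.mk_eq_base_iff H γ).1 hγ)

/-- For a connected, locally path connected space, the family defining the generalized covering
topology is a neighbourhood family, and that topology is finer than the qtop-topology
(in Mathlib, `s ≤ t` for topologies means that `s` is finer than `t`). -/
theorem mainTheorem6 (X : Type*) [TopologicalSpace X] [ConnectedSpace X]
    [LocallyPathConnectedSpace X] (x₀ : X) :
    IsNeighbourhoodFamily (gcovFamily X x₀) ∧ gcovTopology X x₀ ≤ Pi1.qtop X x₀ := by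
  have hC : Pi1.qtopKernel X x₀ ∈ gcovFamily X x₀ :=
    mem_gcovFamily_of_isOpen_compl Pi1.isOpen_compl_qtopKernel
  refine ⟨⟨⟨_, hC⟩, fun H hH K hK => ⟨H ⊓ K, inf_mem_gcovFamily hH hK, le_rfl⟩⟩, ?_⟩
  intro U hU
  let _ := gcovTopology X x₀
  -- The coset of the kernel through `g` is a basic open set contained in `U`.
  refine isOpen_iff_forall_mem_open.2 fun g hg =>
    ⟨g • (Pi1.qtopKernel X x₀ : Set (Pi1 X x₀)), ?_,
      TopologicalSpace.isOpen_generateFrom_of_mem ⟨g, _, hC, rfl⟩,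
      ⟨1, Subgroup.one_mem _, mul_one g⟩⟩
  rintro _ ⟨c, hc, rfl⟩
  exact Pi1.mul_mem_of_mem_qtopKernel hU hg hc
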